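/- Let $F=(f_1,\dots,f_N)$ be a vector field with $f_i\in\mathbb R[x]=\mathbb R[x_1,\dots,x_N]$, and let $\mathcal L(p)=\sum_i \frac{\partial p}{\partial x_i} f_i$ be the Lie derivative, with iterates $\mathcal L^{(j)}$. For $x_0\in\mathbb R^N$ let $x(t;x_0)$ be the solution of $\dot x=F(x)$, $x(0)=x_0$, given by its Taylor series at $0$ on the largest symmetric open interval $D_{x_0}$ where the Taylor series at $0$ of all components converge. A polynomial $p$ is a polynomial invariant for $x_0$ if $p(t;x_0)$, the sum of the Taylor series at $t=0$ of $t\mapsto p(x(t;x_0))$ on its largest symmetric open interval of convergence, is identically $0$. For a real algebraic variety $\psi\subseteq\mathbb R^N$ let $\mathrm{Id}(\psi)$ be the ideal of polynomials vanishing on $\psi$, let $\phi_\psi$ be the smallest algebraic variety $\phi$ such that $x(t;x_0)\in\phi$ for all $x_0\in\psi$ and $t\in D_{x_0}$, and let $I_\psi=\mathrm{Id}(\phi_\psi)$. A template is a polynomial $\pi$ in $x$ whose coefficients are linear forms in parameters $a=(a_1,\dots,a_n)$, regarded as an element of $\mathbb R[a,x]$. For $v\in\mathbb R^n$, $\pi[v]\in\mathbb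 R[x]$ is obtained by setting $a=v$, and $\pi[S]=\{\pi[v]:v\in S\}$. Let $\pi^{(j)}=\mathcal L^{(j)}(\pi)$, the parameters being treated as constants. Fix a monomial order on $\mathbb R[a,x]$ (for instance a lexicographic one with $a_k>x_i$ for all $k,i$) and a Gröbner basis $G\subseteq\mathbb R[x]$ of $\mathrm{Id}(\psi)$ for the restricted order on $\mathbb R[x]$. Let $r_j=\pi^{(j)}\bmod G$ be the remainder of division in $\mathbb R[a,x]$, and for $i\ge 0$ put $$V_i=\{v\in\mathbb R^n: r_j[v]=0 \text{ for } j=0,\dots,i\},\qquad J_i=\Big\langle \bigcup_{j=0}^{i}\pi^{(j)}[V_i]\Big\rangle .$$ Then there is an index $m$ with $V_{m+1}=V_m$ and $J_{m+1}=J_m$. For the least such $m$ define $\mathrm{POST}(\psi,\pi)=(V,J)=(V_m,J_m)$. Then: (a) $\pi[V]=\pi[\mathbb R^n]\cap I_\psi$; moreover $\pi[V]$ consists exactly of those polynomials in $\pi[\mathbb R^n]$ that are polynomial invariants for every $x_0\in\psi$. (b) $J$ is the smallest ideal of $\mathbb R[x]$ that contains $\pi[V]$ and is invariant, i.e. satisfies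 $\mathcal L(J)\subseteq J$; moreover $J\subseteq I_\psi$. -/

import Mathlib

namespace PolyODE

noncomputable section

open MvPolynomial

/-! ### Polynomial vector fields, trajectories and polynomial behaviours -/

/-- `x` solves `x' = F(x)`, `x(0) = x₀` on some open interval around `0`. -/
def IsLocalSolution {N : ℕ} (F : Fin N → MvPolynomial (Fin N) ℝ) (x₀ : Fin N → ℝ)
    (x : ℝ → Fin N → ℝ) : Prop :=
  x 0 = x₀ ∧ ∃ ε > (0 : ℝ), ∀ t ∈ Set.Ioo (-ε) ε, HasDerivAt x (fun i => eval (x t) (F i)) t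

/-- Local solutions exist (Picard-Lindelöf). -/
theorem exists_isLocalSolution {N : ℕ} (F : Fin N → MvPolynomial (Fin N) ℝ) (x₀ : Fin N → ℝ) :
    ∃ x : ℝ → Fin N → ℝ, IsLocalSolution F x₀ x := by
  have hF : ContDiffAt ℝ 1 (fun y : Fin N → ℝ => fun i => eval y (F i)) x₀ := by
    rw [contDiffAt_pi]
    intro i
    have h : AnalyticAt ℝ (fun y : Fin N → ℝ => aeval (fun k => y k) (F i)) x₀ :=
      AnalyticAt.aeval_mvPolynomial (f := fun (y : Fin N → ℝ) k => y k)
        (fun k => (ContinuousLinearMap.proj (R := ℝ) (φ := fun _ : Fin N => ℝ) k).analyticAt x₀)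
        (F i)
    exact h.contDiffAt
  obtain ⟨x, hx0, ε, hε, hx⟩ :=
    hF.exists_forall_mem_closedBall_exists_eq_forall_mem_Ioo_hasDerivAt₀ 0
  exact ⟨x, hx0, ε, hε, fun t ht => hx t (by simpa using ht)⟩

/-- A local solution. Its germ at `0` does not depend on the choice. -/
def localSolution {N : ℕ} (F : Fin N → MvPolynomial (Fin N) ℝ) (x₀ : Fin N → ℝ) :
    ℝ → Fin N → ℝ :=
  Classical.choose (exists_isLocalSolution F x₀)

/-- The Taylor series at `0` of a function of one real variable. -/
def taylorSeries (g : ℝ → ℝ) : FormalMultilinearSeries ℝ ℝ ℝ :=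
  FormalMultilinearSeries.ofScalars ℝ (fun j : ℕ => iteratedDeriv j g 0 / (j.factorial : ℝ))

/-- The largest symmetric open interval on which the Taylor series at `0` of all the components
of the solution converge. -/
def trajectoryDomain {N : ℕ} (F : Fin N → MvPolynomial (Fin N) ℝ) (x₀ : Fin N → ℝ) : Set ℝ :=
  {t | ENNReal.ofReal |t| < ⨅ i : Fin N, (taylorSeries fun s => localSolution F x₀ s i).radius}

/-- The time trajectory `x(t; x₀)`, meaningful for `t` in `trajectoryDomain F x₀`: the sum of the
Taylor series at `0` of the solution. -/
def trajectory {N : ℕ} (F : Fin N → MvPolynomial (Fin N) ℝ) (x₀ : Fin N → ℝ) :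
    ℝ → Fin N → ℝ :=
  fun t i => (taylorSeries fun s => localSolution F x₀ s i).sum t

/-- The Taylor series at `0` of `t ↦ p(x(t; x₀))`. -/
def behaviourSeries {N : ℕ} (F : Fin N → MvPolynomial (Fin N) ℝ) (x₀ : Fin N → ℝ)
    (p : MvPolynomial (Fin N) ℝ) : FormalMultilinearSeries ℝ ℝ ℝ :=
  taylorSeries fun t => eval (trajectory F x₀ t) p

/-- `p` is a polynomial invariant for `F` and `x₀`: the polynomial behaviour `p(t; x₀)`, that is
the sum of the Taylor series of `t ↦ p(x(t; x₀))` on its largest symmetric open interval of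
convergence, is identically zero. -/
def IsPolynomialInvariant {N : ℕ} (F : Fin N → MvPolynomial (Fin N) ℝ) (x₀ : Fin N → ℝ)
    (p : MvPolynomial (Fin N) ℝ) : Prop :=
  ∀ t : ℝ, ENNReal.ofReal |t| < (behaviourSeries F x₀ p).radius →
    (behaviourSeries F x₀ p).sum t = 0

/-! ### Varieties, safety assertions, strongest postconditions -/

/-- `A` is a real algebraic variety: the common zero set of a set of polynomials. -/
def IsAlgebraicVariety {N : ℕ} (A : Set (Fin N → ℝ)) : Prop :=
  ∃ P : Set (MvPolynomial (Fin N) ℝ), A = zeroLocus ℝ (Ideal.span P)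

/-- The safety assertion `ψ ⟶ [F] φ`. -/
def Safe {N : ℕ} (F : Fin N → MvPolynomial (Fin N) ℝ) (ψ φ : Set (Fin N → ℝ)) : Prop :=
  ∀ x₀ ∈ ψ, ∀ t ∈ trajectoryDomain F x₀, trajectory F x₀ t ∈ φ

/-- `φ_ψ`: the smallest algebraic variety `φ` with `ψ ⟶ [F] φ`, as the intersection of all of
them. -/
def strongestPost {N : ℕ} (F : Fin N → MvPolynomial (Fin N) ℝ) (ψ : Set (Fin N → ℝ)) :
    Set (Fin N → ℝ) :=
  ⋂₀ {φ | IsAlgebraicVariety φ ∧ Safe F ψ φ}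

/-- `I_ψ`: the ideal of all polynomials that vanish on `φ_ψ`. -/
def postIdeal {N : ℕ} (F : Fin N → MvPolynomial (Fin N) ℝ) (ψ : Set (Fin N → ℝ)) :
    Ideal (MvPolynomial (Fin N) ℝ) :=
  vanishingIdeal ℝ (strongestPost F ψ)

/-! ### Lie derivatives and invariant ideals -/

/-- The Lie derivative of a polynomial along `F`. -/
def lie {N : ℕ} (F : Fin N → MvPolynomial (Fin N) ℝ) (p : MvPolynomial (Fin N) ℝ) :
    MvPolynomial (Fin N) ℝ :=
  ∑ i, pderiv i p * F i

/-- Ideals closed under the Lie derivative. -/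
def IsInvariantIdeal {N : ℕ} (F : Fin N → MvPolynomial (Fin N) ℝ)
    (J : Ideal (MvPolynomial (Fin N) ℝ)) : Prop :=
  ∀ p ∈ J, lie F p ∈ J

/-! ### Templates

The ring `ℝ[a, x]` is `MvPolynomial (Fin n ⊕ Fin N) ℝ`; `Sum.inl` gives the parameters `a` and
`Sum.inr` the variables `x`. -/

/-- `π` is a template, an element of `Lin(a)[x]`: in every monomial of `π` the total degree in the
parameters is exactly one. -/
def IsTemplate {n N : ℕ} (π : MvPolynomial (Fin n ⊕ Fin N) ℝ) : Prop :=
  ∀ d ∈ π.support, ∑ k : Fin n, d (Sum.inl k) = 1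

/-- `π[v]`: replace each parameter `a k` by `v k`. -/
def inst {n N : ℕ} (v : Fin n → ℝ) (π : MvPolynomial (Fin n ⊕ Fin N) ℝ) :
    MvPolynomial (Fin N) ℝ :=
  aeval (Sum.elim (fun k => C (v k)) X) π

/-- `π[S] = {π[v] : v ∈ S}`. -/
def instSet {n N : ℕ} (π : MvPolynomial (Fin n ⊕ Fin N) ℝ) (S : Set (Fin n → ℝ)) :
    Set (MvPolynomial (Fin N) ℝ) :=
  (fun v => inst v π) '' S

/-- The formal Lie derivative of a template; the parameters are constants. -/
def templateLie {n N : ℕ} (F : Fin N → MvPolynomial (Fin N) ℝ)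
    (π : MvPolynomial (Fin n ⊕ Fin N) ℝ) : MvPolynomial (Fin n ⊕ Fin N) ℝ :=
  ∑ i : Fin N, pderiv (Sum.inr i) π * rename Sum.inr (F i)

/-! ### Multivariate division and Gröbner bases -/

/-- `r` is a remainder of the division of `f` by `G` for the monomial order `m`: `f - r` is a
combination `∑ g ∈ G, h g * g` whose terms have multidegree at most that of `f`, and no monomial
of `r` is divisible by the leading monomial of a (nonzero) element of `G`. -/
def IsRemainder {τ : Type*} (m : MonomialOrder τ) (G : Finset (MvPolynomial τ ℝ))
    (f r : MvPolynomial τ ℝ) : Prop :=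
  (∃ h : MvPolynomial τ ℝ → MvPolynomial τ ℝ,
    f = ∑ g ∈ G, h g * g + r ∧
      ∀ g ∈ G, m.toSyn (m.degree (h g * g)) ≤ m.toSyn (m.degree f)) ∧
  ∀ c ∈ r.support, ∀ g ∈ G, g ≠ 0 → ¬ m.degree g ≤ c

theorem exists_isRemainder {τ : Type*} (m : MonomialOrder τ) (G : Finset (MvPolynomial τ ℝ))
    (f : MvPolynomial τ ℝ) : ∃ r, IsRemainder m G f r := by
  classical
  obtain ⟨q, r, h1, h2, h3⟩ := m.div_set (B := {g | g ∈ G ∧ g ≠ 0})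
    (fun b hb => by simpa [MonomialOrder.leadingCoeff_eq_zero_iff] using hb.2) f
  let h : MvPolynomial τ ℝ → MvPolynomial τ ℝ :=
    fun g => if hg : g ∈ G ∧ g ≠ 0 then q ⟨g, hg⟩ else 0
  refine ⟨r, ⟨h, ?_, ?_⟩, fun c hc g hg hg0 => h3 c hc g ⟨hg, hg0⟩⟩
  · conv_lhs => rw [h1]
    congr 1
    rw [Finsupp.linearCombination_apply]
    have e1 : ∀ b : {g | g ∈ G ∧ g ≠ 0},
        q b • (b : MvPolynomial τ ℝ) = h b * (b : MvPolynomial τ ℝ) := by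
      rintro ⟨b, hb⟩
      have hb' : b ∈ G ∧ b ≠ 0 := hb
      simp only [smul_eq_mul, h]
      rw [dif_pos hb']
    rw [Finsupp.sum, Finset.sum_congr rfl (fun b _ => e1 b)]
    refine (Finset.sum_map q.support ⟨Subtype.val, Subtype.val_injective⟩
      (fun g => h g * g)).symm.trans ?_
    refine Finset.sum_subset ?_ ?_
    · intro g hg
      simp only [Finset.mem_map, Function.Embedding.coeFn_mk] at hg
      obtain ⟨b, _, rfl⟩ := hg
      exact b.2.1
    · intro g hg hg'
      by_cases hg0 : g = 0
      · simp [hg0]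
      · have : q ⟨g, hg, hg0⟩ = 0 := by
          by_contra hne
          apply hg'
          simp only [Finset.mem_map, Function.Embedding.coeFn_mk]
          exact ⟨⟨g, hg, hg0⟩, by simpa using hne, rfl⟩
        simp only [h]
        rw [dif_pos ⟨hg, hg0⟩, this, zero_mul]
  · intro g hg
    by_cases hg0 : g = 0
    · simp [hg0]
    · simp only [h]
      rw [dif_pos ⟨hg, hg0⟩, mul_comm]
      exact h2 ⟨g, hg, hg0⟩

/-- `f mod G`. When `G` is a Gröbner basis there is only one remainder. -/
def polyMod {τ : Type*} (m : MonomialOrder τ) (G : Finset (MvPolynomial τ ℝ))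
    (f : MvPolynomial τ ℝ) : MvPolynomial τ ℝ :=
  Classical.choose (exists_isRemainder m G f)

/-- The finite set `G` is a Gröbner basis of `I`: it generates `I`, and the leading monomial of
every nonzero element of `I` is divisible by that of an element of `G`. -/
def IsGroebnerBasis {τ : Type*} (m : MonomialOrder τ) (G : Finset (MvPolynomial τ ℝ))
    (I : Ideal (MvPolynomial τ ℝ)) : Prop :=
  Ideal.span (G : Set (MvPolynomial τ ℝ)) = I ∧
    ∀ f ∈ I, f ≠ 0 → ∃ g ∈ G, g ≠ 0 ∧ m.degree g ≤ m.degree f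

/-- The monomial order `mx` on `ℝ[x]` is the restriction of the monomial order `m` on
`ℝ[a, x]`. -/
def IsRestriction {n N : ℕ} (mx : MonomialOrder (Fin N)) (m : MonomialOrder (Fin n ⊕ Fin N)) :
    Prop :=
  ∀ c d : Fin N →₀ ℕ, mx.toSyn c ≤ mx.toSyn d ↔
    m.toSyn (c.mapDomain Sum.inr) ≤ m.toSyn (d.mapDomain Sum.inr)

/-! ### The POST algorithm -/

/-- `r_j`: the remainder in `ℝ[a, x]` of the `j`-th Lie derivative of `π` modulo `G ⊆ ℝ[x]`. -/
def postRem {n N : ℕ} (F : Fin N → MvPolynomial (Fin N) ℝ) (m : MonomialOrder (Fin n ⊕ Fin N))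
    (G : Finset (MvPolynomial (Fin N) ℝ)) (π : MvPolynomial (Fin n ⊕ Fin N) ℝ) (j : ℕ) :
    MvPolynomial (Fin n ⊕ Fin N) ℝ :=
  polyMod m
    (G.map ⟨rename Sum.inr, rename_injective (R := ℝ) (Sum.inr : Fin N → Fin n ⊕ Fin N)
      Sum.inr_injective⟩)
    ((templateLie F)^[j] π)

/-- `V_i`. -/
def postV {n N : ℕ} (F : Fin N → MvPolynomial (Fin N) ℝ) (m : MonomialOrder (Fin n ⊕ Fin N))
    (G : Finset (MvPolynomial (Fin N) ℝ)) (π : MvPolynomial (Fin n ⊕ Fin N) ℝ) (i : ℕ) :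
    Set (Fin n → ℝ) :=
  {v | ∀ j ≤ i, inst v (postRem F m G π j) = 0}

/-- `J_i`. -/
def postJ {n N : ℕ} (F : Fin N → MvPolynomial (Fin N) ℝ) (m : MonomialOrder (Fin n ⊕ Fin N))
    (G : Finset (MvPolynomial (Fin N) ℝ)) (π : MvPolynomial (Fin n ⊕ Fin N) ℝ) (i : ℕ) :
    Ideal (MvPolynomial (Fin N) ℝ) :=
  Ideal.span (⋃ j ≤ i, instSet ((templateLie F)^[j] π) (postV F m G π i))

/-- The indices at which both chains are stationary for one step. -/
def stopSet {n N : ℕ} (F : Fin N → MvPolynomial (Fin N) ℝ) (m : MonomialOrder (Fin n ⊕ Fin N))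
    (G : Finset (MvPolynomial (Fin N) ℝ)) (π : MvPolynomial (Fin n ⊕ Fin N) ℝ) : Set ℕ :=
  {i | postV F m G π (i + 1) = postV F m G π i ∧ postJ F m G π (i + 1) = postJ F m G π i}

/-- `POST(ψ, π) = (V_i, J_i)` for the least `i` in `stopSet`, where `G` is a Gröbner basis of the
vanishing ideal of `ψ`. -/
def post {n N : ℕ} (F : Fin N → MvPolynomial (Fin N) ℝ) (m : MonomialOrder (Fin n ⊕ Fin N))
    (G : Finset (MvPolynomial (Fin N) ℝ)) (π : MvPolynomial (Fin n ⊕ Fin N) ℝ) :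
    Set (Fin n → ℝ) × Ideal (MvPolynomial (Fin N) ℝ) :=
  (postV F m G π (sInf (stopSet F m G π)), postJ F m G π (sInf (stopSet F m G π)))

end

end PolyODE

open PolyODE

/-!
The geometric side of the statement reduces to a condition on Lie derivatives. Along a solution,
the `j`-th derivative of `t ↦ p(x(t; x₀))` is `t ↦ ℒ⁽ʲ⁾(p)(x(t; x₀))`. A weighted coefficient norm
shows that `ℒ⁽ʲ⁾(p)` is at most `C Kʲ j!` on bounded sets (`exists_iterate_lie_bound`), so by Taylor's
formula this function is analytic at `0` with coefficients `ℒ⁽ʲ⁾(p)(x₀) / j!`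
(`IsLocalSolution.hasFPowerSeriesAt_eval`). Hence `p` is a polynomial invariant for `x₀` iff all
`ℒ⁽ʲ⁾(p)` vanish at `x₀` (`isPolynomialInvariant_iff`), and, by the identity theorem on the
trajectory domain, `p ∈ I_ψ` iff all `ℒ⁽ʲ⁾(p)` lie in `Id(ψ)` (`mem_postIdeal_iff`).

On the algebraic side, instantiating parameters commutes with `ℒ` and respects reduction modulo a
Gröbner basis in `ℝ[x]` (`inst_polyMod_eq_zero_iff`), so `v ∈ V_i` iff `ℒ⁽ʲ⁾(π[v]) ∈ Id(ψ)` for all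
`j ≤ i`. The `V_i` are descending subspaces of `ℝⁿ`; once they are constant the ideals `J_i` ascend,
and both chains stop (`stopSet_nonempty`). If both stand still for one step, then `J_i` is
invariant (`isInvariantIdeal_postJ`); since `J_i ⊆ Id(ψ)`, every `v ∈ V_i` has all `ℒ⁽ʲ⁾(π[v])` in
`Id(ψ)`, which is the condition found on the geometric side.
-/

namespace PolyODE

open MvPolynomial Filter Topology

section Algebra

variable {n N : ℕ}

/-! ### Instantiating templates -/

theorem inst_rename (v : Fin n → ℝ) (q : MvPolynomial (Fin N) ℝ) :
    inst v (rename Sum.inr q) = q := by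
  rw [inst, aeval_rename, Sum.elim_comp_inr, aeval_X_left_apply]

theorem inst_monomial (v : Fin n → ℝ) (d : Fin n ⊕ Fin N →₀ ℕ) (c : ℝ) :
    inst v (monomial d c) =
      monomial (d.comapDomain Sum.inr Sum.inr_injective.injOn) (c * ∏ k, v k ^ d (Sum.inl k)) := by
  rw [inst, aeval_monomial, Finsupp.prod_fintype _ _ (by simp), Fintype.prod_sum_type,
    monomial_eq, Finsupp.prod_fintype _ _ (by simp)]
  simp [algebraMap_eq, mul_assoc]

/-- Instantiating the parameters creates no new `x`-part: each monomial of `r[v]` is the `x`-part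
of a monomial of `r`. -/
theorem exists_mem_support_of_mem_support_inst (v : Fin n → ℝ)
    (r : MvPolynomial (Fin n ⊕ Fin N) ℝ) {b : Fin N →₀ ℕ} (hb : b ∈ (inst v r).support) :
    ∃ c ∈ r.support, c.comapDomain Sum.inr Sum.inr_injective.injOn = b := by
  classical
  by_contra! h
  refine (mem_support_iff.1 hb) ?_
  have : inst v r = ∑ c ∈ r.support, inst v (monomial c (coeff c r)) := by
    conv_lhs => rw [r.as_sum]
    rw [inst, map_sum]
    rfl
  rw [this, coeff_sum]
  refine Finset.sum_eq_zero fun c hc => ?_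
  rw [inst_monomial, coeff_monomial, if_neg (h c hc)]

theorem inst_pderiv_inr (v : Fin n → ℝ) (i : Fin N) (p : MvPolynomial (Fin n ⊕ Fin N) ℝ) :
    inst v (pderiv (Sum.inr i) p) = pderiv i (inst v p) := by
  simp only [inst]
  induction p using MvPolynomial.induction_on with
  | C a => simp [algebraMap_eq]
  | add p q hp hq => simp only [map_add, hp, hq]
  | mul_X p q h =>
    simp only [Derivation.leibniz, pderiv_X, smul_eq_mul, map_add, map_mul, aeval_X, h]
    cases q <;> simp [Pi.single_apply]

theorem inst_templateLie (F : Fin N → MvPolynomial (Fin N) ℝ) (v : Fin n → ℝ)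
    (p : MvPolynomial (Fin n ⊕ Fin N) ℝ) : inst v (templateLie F p) = lie F (inst v p) := by
  have h : inst v (templateLie F p) =
      ∑ i, inst v (pderiv (Sum.inr i) p) * inst v (rename Sum.inr (F i)) := by
    simp [templateLie, inst]
  simp only [h, inst_pderiv_inr, inst_rename, lie]

theorem inst_iterate_templateLie (F : Fin N → MvPolynomial (Fin N) ℝ) (v : Fin n → ℝ)
    (p : MvPolynomial (Fin n ⊕ Fin N) ℝ) (j : ℕ) :
    inst v ((templateLie F)^[j] p) = (lie F)^[j] (inst v p) :=
  Function.Semiconj.iterate_right (f := inst v) (inst_templateLie F v) j p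

/-! ### The Lie derivative and invariant ideals -/

theorem lie_add (F : Fin N → MvPolynomial (Fin N) ℝ) (p q : MvPolynomial (Fin N) ℝ) :
    lie F (p + q) = lie F p + lie F q := by
  simp [lie, add_mul, Finset.sum_add_distrib]

theorem lie_mul (F : Fin N → MvPolynomial (Fin N) ℝ) (p q : MvPolynomial (Fin N) ℝ) :
    lie F (p * q) = p * lie F q + q * lie F p := by
  simp only [lie, Derivation.leibniz, smul_eq_mul, add_mul, Finset.sum_add_distrib,
    Finset.mul_sum, mul_assoc]

theorem lie_C (F : Fin N → MvPolynomial (Fin N) ℝ) (c : ℝ) : lie F (C c) = 0 := by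
  simp [lie]

theorem lie_X (F : Fin N → MvPolynomial (Fin N) ℝ) (i : Fin N) : lie F (X i) = F i := by
  classical
  simp [lie, pderiv_X, Pi.single_apply]

theorem lie_smul (F : Fin N → MvPolynomial (Fin N) ℝ) (c : ℝ) (p : MvPolynomial (Fin N) ℝ) :
    lie F (c • p) = c • lie F p := by
  simp [lie, Finset.smul_sum]

theorem isInvariantIdeal_span {F : Fin N → MvPolynomial (Fin N) ℝ}
    {S : Set (MvPolynomial (Fin N) ℝ)} (h : ∀ p ∈ S, lie F p ∈ Ideal.span S) :
    IsInvariantIdeal F (Ideal.span S) := by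
  intro p hp
  induction hp using Submodule.span_induction with
  | mem p hp => exact h p hp
  | zero => simp [lie]
  | add p q _ _ hp hq => rw [lie_add]; exact add_mem hp hq
  | smul a p hp' hp =>
    rw [smul_eq_mul, lie_mul]
    exact add_mem (Ideal.mul_mem_left _ _ hp) (Ideal.mul_mem_right _ _ hp')

theorem IsInvariantIdeal.iterate_lie_mem {F : Fin N → MvPolynomial (Fin N) ℝ}
    {J : Ideal (MvPolynomial (Fin N) ℝ)} (hJ : IsInvariantIdeal F J)
    {p : MvPolynomial (Fin N) ℝ} (hp : p ∈ J) (j : ℕ) : (lie F)^[j] p ∈ J := by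
  induction j with
  | zero => exact hp
  | succ j ih => rw [Function.iterate_succ_apply']; exact hJ _ ih

/-! ### Linearity of templates in the parameters -/

/-- In each monomial of a template exactly one parameter occurs, to the first power; hence `π[v]` is
linear in `v`. -/
theorem IsTemplate.exists_linearMap {π : MvPolynomial (Fin n ⊕ Fin N) ℝ} (hπ : IsTemplate π) :
    ∃ φ : (Fin n → ℝ) →ₗ[ℝ] MvPolynomial (Fin N) ℝ, ∀ v, φ v = inst v π := by
  classical
  have key : ∀ d ∈ π.support, ∃ k, ∀ v : Fin n → ℝ, inst v (monomial d (coeff d π)) =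
      v k • monomial (d.comapDomain Sum.inr Sum.inr_injective.injOn) (coeff d π) := by
    intro d hd
    obtain ⟨k, hk⟩ : ∃ k, d (Sum.inl k) ≠ 0 := by
      by_contra! h
      simpa [h] using hπ d hd
    have hsum := hπ d hd
    rw [← Finset.add_sum_erase _ _ (Finset.mem_univ k)] at hsum
    have hk1 : d (Sum.inl k) = 1 := by omega
    have h0 : ∑ l ∈ Finset.univ.erase k, d (Sum.inl l) = 0 := by omega
    rw [Finset.sum_eq_zero_iff] at h0
    refine ⟨k, fun v => ?_⟩
    rw [inst_monomial, Finset.prod_eq_single k, hk1, pow_one, smul_monomial, smul_eq_mul, mul_comm]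
    · intro l _ hl
      rw [h0 l (by simp [hl]), pow_zero]
    · simp
  choose k hk using key
  refine ⟨∑ d ∈ π.support.attach, (LinearMap.proj (k d d.2)).smulRight
    (monomial (d.1.comapDomain Sum.inr Sum.inr_injective.injOn) (coeff d π)), fun v => ?_⟩
  conv_rhs => rw [π.as_sum]
  simp only [LinearMap.sum_apply, LinearMap.smulRight_apply, LinearMap.proj_apply]
  rw [inst, map_sum]
  refine Eq.trans (Finset.sum_congr rfl fun d _ => (hk d.1 d.2 v).symm) ?_
  exact Finset.sum_attach π.support fun d => inst v (monomial d (coeff d π))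

/-! ### Division by a Gröbner basis in fewer variables -/

theorem degree_rename_inr {mx : MonomialOrder (Fin N)} {m : MonomialOrder (Fin n ⊕ Fin N)}
    (hm : IsRestriction mx m) {g : MvPolynomial (Fin N) ℝ} (hg : g ≠ 0) :
    m.degree (rename Sum.inr g : MvPolynomial (Fin n ⊕ Fin N) ℝ) =
      (mx.degree g).mapDomain Sum.inr := by
  classical
  have hinj : Function.Injective (Sum.inr : Fin N → Fin n ⊕ Fin N) := Sum.inr_injective
  have hg' : (rename Sum.inr g : MvPolynomial (Fin n ⊕ Fin N) ℝ) ≠ 0 := by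
    rwa [Ne, map_eq_zero_iff _ (rename_injective _ hinj)]
  apply m.toSyn.injective
  apply le_antisymm
  · obtain ⟨b, hb, hbd⟩ : ∃ b ∈ g.support, b.mapDomain Sum.inr =
        m.degree (rename Sum.inr g : MvPolynomial (Fin n ⊕ Fin N) ℝ) := by
      have := (m.degree_mem_support_iff _).2 hg'
      rw [support_rename_of_injective hinj] at this
      simpa using this
    rw [← hbd]
    exact (hm _ _).1 (mx.le_degree hb)
  · apply m.le_degree
    rw [support_rename_of_injective hinj]
    exact Finset.mem_image_of_mem _ ((mx.degree_mem_support_iff g).2 hg)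

/-- The remainder of `f` in `ℝ[a, x]` modulo a Gröbner basis `G ⊆ ℝ[x]` of `I`, instantiated at
`v`, decides whether `f[v] ∈ I`. Divisibility of a monomial by a leading monomial of `G` depends only
on the `x`-part of the monomial, so the instantiated remainder is still reduced modulo `G`; a reduced
polynomial in `I` is zero. -/
theorem inst_polyMod_eq_zero_iff {mx : MonomialOrder (Fin N)} {m : MonomialOrder (Fin n ⊕ Fin N)}
    (hm : IsRestriction mx m) {G : Finset (MvPolynomial (Fin N) ℝ)}
    {I : Ideal (MvPolynomial (Fin N) ℝ)} (hG : IsGroebnerBasis mx G I)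
    (f : MvPolynomial (Fin n ⊕ Fin N) ℝ) (v : Fin n → ℝ) :
    inst v (polyMod m (G.map ⟨rename Sum.inr, rename_injective (R := ℝ)
      (Sum.inr : Fin N → Fin n ⊕ Fin N) Sum.inr_injective⟩) f) = 0 ↔ inst v f ∈ I := by
  have hr := Classical.choose_spec (exists_isRemainder m (G.map ⟨rename Sum.inr, rename_injective
    (R := ℝ) (Sum.inr : Fin N → Fin n ⊕ Fin N) Sum.inr_injective⟩) f)
  change IsRemainder _ _ _ (polyMod _ _ _) at hr
  generalize polyMod _ _ _ = r at hr ⊢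
  obtain ⟨⟨h, hf, -⟩, hlm⟩ := hr
  have hfv : inst v f = ∑ g ∈ G, inst v (h (rename Sum.inr g)) * g + inst v r := by
    rw [Finset.sum_map] at hf
    have : inst v f = ∑ g ∈ G, inst v (h (rename Sum.inr g)) * inst v (rename Sum.inr g) +
        inst v r := by
      conv_lhs => rw [hf]
      simp [inst]
    simpa only [inst_rename] using this
  have hsum : ∑ g ∈ G, inst v (h (rename Sum.inr g)) * g ∈ I := by
    rw [← hG.1]
    exact Ideal.sum_mem _ fun g hg => Ideal.mul_mem_left _ _ (Ideal.subset_span hg)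
  constructor
  · intro h0
    rwa [hfv, h0, add_zero]
  · intro hfI
    by_contra hne
    have hrI : inst v r ∈ I := by
      rw [hfv] at hfI
      exact (Submodule.add_mem_iff_right _ hsum).1 hfI
    obtain ⟨g, hg, hg0, hle⟩ := hG.2 _ hrI hne
    obtain ⟨c, hc, hcd⟩ := exists_mem_support_of_mem_support_inst v r
      ((mx.degree_mem_support_iff _).2 hne)
    refine hlm c hc (rename Sum.inr g) (Finset.mem_map_of_mem _ hg) ?_ ?_
    · rwa [Ne, map_eq_zero_iff _ (rename_injective _ Sum.inr_injective)]
    · rw [degree_rename_inr hm hg0]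
      rw [← hcd] at hle
      rintro (k | i)
      · rw [Finsupp.mapDomain_of_notMem_range _ _ (by simp)]
        exact Nat.zero_le _
      · rw [Finsupp.mapDomain_apply Sum.inr_injective]
        exact hle i

/-! ### Termination and invariance for the two chains -/

variable {F : Fin N → MvPolynomial (Fin N) ℝ} {mx : MonomialOrder (Fin N)}
  {m : MonomialOrder (Fin n ⊕ Fin N)} {G : Finset (MvPolynomial (Fin N) ℝ)}
  {I : Ideal (MvPolynomial (Fin N) ℝ)} {π : MvPolynomial (Fin n ⊕ Fin N) ℝ}

theorem mem_postV_iff (hm : IsRestriction mx m) (hG : IsGroebnerBasis mx G I) {i : ℕ}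
    {v : Fin n → ℝ} : v ∈ postV F m G π i ↔ ∀ j ≤ i, (lie F)^[j] (inst v π) ∈ I := by
  simp only [postV, Set.mem_ofPred_eq, postRem, inst_polyMod_eq_zero_iff hm hG,
    inst_iterate_templateLie]

theorem postJ_eq_span (F : Fin N → MvPolynomial (Fin N) ℝ) (m : MonomialOrder (Fin n ⊕ Fin N))
    (G : Finset (MvPolynomial (Fin N) ℝ)) (π : MvPolynomial (Fin n ⊕ Fin N) ℝ) (i : ℕ) :
    postJ F m G π i =
      Ideal.span {p | ∃ j ≤ i, ∃ v ∈ postV F m G π i, (lie F)^[j] (inst v π) = p} := by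
  rw [postJ]
  congr 1
  ext p
  simp [instSet, inst_iterate_templateLie]

theorem postV_antitone (F : Fin N → MvPolynomial (Fin N) ℝ) (m : MonomialOrder (Fin n ⊕ Fin N))
    (G : Finset (MvPolynomial (Fin N) ℝ)) (π : MvPolynomial (Fin n ⊕ Fin N) ℝ) :
    Antitone (postV F m G π) :=
  fun _ _ hik _ hv j hj => hv j (hj.trans hik)

/-- The `V_i` are a descending chain of linear subspaces of `ℝⁿ`, so they are constant from some
index on; from there on the `J_i` form an ascending chain of ideals in a Noetherian ring. -/
theorem stopSet_nonempty (hm : IsRestriction mx m) (hG : IsGroebnerBasis mx G I)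
    (hπ : IsTemplate π) : (stopSet F m G π).Nonempty := by
  obtain ⟨φ, hφ⟩ := hπ.exists_linearMap
  let L : MvPolynomial (Fin N) ℝ →ₗ[ℝ] MvPolynomial (Fin N) ℝ :=
    { toFun := lie F, map_add' := lie_add F, map_smul' := lie_smul F }
  let W : ℕ → Submodule ℝ (Fin n → ℝ) :=
    fun i => ⨅ j ≤ i, (I.restrictScalars ℝ).comap ((L ^ j).comp φ)
  have hW : ∀ i, (W i : Set (Fin n → ℝ)) = postV F m G π i := by
    intro i
    ext v
    rw [mem_postV_iff hm hG]
    simp [W, hφ, Module.End.pow_apply, L]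
  have hWanti : Antitone W := fun i k hik => by
    rw [← SetLike.coe_subset_coe, hW, hW]
    exact postV_antitone F m G π hik
  obtain ⟨a, ha⟩ := IsArtinian.monotone_stabilizes
    (⟨fun i => OrderDual.toDual (W i), hWanti⟩ : ℕ →o (Submodule ℝ (Fin n → ℝ))ᵒᵈ)
  have hV : ∀ i, a ≤ i → postV F m G π i = postV F m G π a := by
    intro i hi
    rw [← hW, ← hW]
    have h : W a = W i := ha i hi
    rw [h]
  have hJmono : Monotone fun i => postJ F m G π (a + i) := by
    intro i k hik
    simp only [postJ_eq_span]
    refine Ideal.span_mono ?_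
    rintro p ⟨j, hj, v, hv, rfl⟩
    refine ⟨j, by omega, v, ?_, rfl⟩
    rwa [hV _ (by omega), ← hV (a + i) (by omega)]
  obtain ⟨b, hb⟩ := monotone_stabilizes_iff_noetherian.2
    (inferInstanceAs (IsNoetherianRing (MvPolynomial (Fin N) ℝ))) ⟨_, hJmono⟩
  refine ⟨a + b, ?_, ?_⟩
  · rw [hV _ (by omega), ← hV (a + b) (by omega)]
  · exact (hb (b + 1) (by omega)).symm

theorem postJ_le (hm : IsRestriction mx m) (hG : IsGroebnerBasis mx G I) (i : ℕ) :
    postJ F m G π i ≤ I := by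
  rw [postJ_eq_span, Ideal.span_le]
  rintro p ⟨j, hj, v, hv, rfl⟩
  exact (mem_postV_iff hm hG).1 hv j hj

theorem inst_mem_postJ {i : ℕ} {v : Fin n → ℝ} (hv : v ∈ postV F m G π i) :
    inst v π ∈ postJ F m G π i := by
  rw [postJ_eq_span]
  exact Ideal.subset_span ⟨0, Nat.zero_le _, v, hv, rfl⟩

/-- When both chains stand still for one step, `ℒ` maps the generators `π⁽ʲ⁾[v]`, `j ≤ i`, of `J_i`
into `J_{i+1} = J_i`. -/
theorem isInvariantIdeal_postJ {i : ℕ} (hi : i ∈ stopSet F m G π) :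
    IsInvariantIdeal F (postJ F m G π i) := by
  have h := hi.2
  rw [postJ_eq_span F m G π i] at h ⊢
  refine isInvariantIdeal_span ?_
  rintro p ⟨j, hj, v, hv, rfl⟩
  rw [← h, ← Function.iterate_succ_apply' (lie F), postJ_eq_span]
  exact Ideal.subset_span ⟨j + 1, by omega, v, by rwa [hi.1], rfl⟩

/-- At a stopping index the first `i` membership conditions imply all of them, because all
derivatives stay in the invariant ideal `J_i ⊆ I`. In particular the chain `V` cannot resume its descent
later. -/
theorem mem_postV_iff_of_mem_stopSet (hm : IsRestriction mx m) (hG : IsGroebnerBasis mx G I)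
    {i : ℕ} (hi : i ∈ stopSet F m G π) {v : Fin n → ℝ} :
    v ∈ postV F m G π i ↔ ∀ j, (lie F)^[j] (inst v π) ∈ I :=
  ⟨fun hv j => postJ_le hm hG i
    ((isInvariantIdeal_postJ hi).iterate_lie_mem (inst_mem_postJ hv) j),
   fun h => (mem_postV_iff hm hG).2 fun j _ => h j⟩

theorem isLeast_postJ {i : ℕ} (hi : i ∈ stopSet F m G π) :
    IsLeast {I : Ideal (MvPolynomial (Fin N) ℝ) | IsInvariantIdeal F I ∧
      instSet π (postV F m G π i) ⊆ (I : Set (MvPolynomial (Fin N) ℝ))} (postJ F m G π i) := by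
  refine ⟨⟨isInvariantIdeal_postJ hi, ?_⟩, fun I' hI' => ?_⟩
  · rintro _ ⟨v, hv, rfl⟩
    exact inst_mem_postJ hv
  · rw [postJ_eq_span, Ideal.span_le]
    rintro p ⟨j, -, v, hv, rfl⟩
    exact hI'.1.iterate_lie_mem (hI'.2 ⟨v, hv, rfl⟩) j

end Algebra

section Majorant

/-! ### A weighted coefficient norm -/

variable {σ : Type*} {R : ℝ}

/-- The weighted `ℓ¹`-norm of the coefficients, `∑ |c_d| R^|d|`, which bounds the polynomial on the
polydisc of radius `R`. -/
noncomputable def polydiscNorm (R : ℝ) (p : MvPolynomial σ ℝ) : ℝ :=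
  ∑ d ∈ p.support, |coeff d p| * R ^ d.degree

theorem polydiscNorm_eq_sum_of_subset (R : ℝ) {p : MvPolynomial σ ℝ} {S : Finset (σ →₀ ℕ)}
    (hS : p.support ⊆ S) : polydiscNorm R p = ∑ d ∈ S, |coeff d p| * R ^ d.degree :=
  Finset.sum_subset hS fun d _ hd => by rw [notMem_support_iff.1 hd, abs_zero, zero_mul]

theorem polydiscNorm_nonneg (hR : 0 ≤ R) (p : MvPolynomial σ ℝ) : 0 ≤ polydiscNorm R p :=
  Finset.sum_nonneg fun _ _ => by positivity

theorem polydiscNorm_add_le (hR : 0 ≤ R) (p q : MvPolynomial σ ℝ) :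
    polydiscNorm R (p + q) ≤ polydiscNorm R p + polydiscNorm R q := by
  classical
  rw [polydiscNorm_eq_sum_of_subset R (support_add (p := p) (q := q)),
    polydiscNorm_eq_sum_of_subset R (Finset.subset_union_left (s₁ := p.support) (s₂ := q.support)),
    polydiscNorm_eq_sum_of_subset R (Finset.subset_union_right (s₁ := p.support) (s₂ := q.support)),
    ← Finset.sum_add_distrib]
  refine Finset.sum_le_sum fun d _ => ?_
  rw [coeff_add, ← add_mul]
  gcongr
  exact abs_add_le _ _

theorem polydiscNorm_sum_le (hR : 0 ≤ R) {ι : Type*} (s : Finset ι) (f : ι → MvPolynomial σ ℝ) :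
    polydiscNorm R (∑ i ∈ s, f i) ≤ ∑ i ∈ s, polydiscNorm R (f i) :=
  Finset.le_sum_of_subadditive _ (by simp [polydiscNorm]) (polydiscNorm_add_le hR) s f

theorem polydiscNorm_monomial (R : ℝ) (d : σ →₀ ℕ) (c : ℝ) :
    polydiscNorm R (monomial d c) = |c| * R ^ d.degree := by
  classical
  rw [polydiscNorm_eq_sum_of_subset R (support_monomial_subset (s := d) (a := c)),
    Finset.sum_singleton, coeff_monomial, if_pos rfl]

theorem polydiscNorm_mul_le (hR : 0 ≤ R) (p q : MvPolynomial σ ℝ) :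
    polydiscNorm R (p * q) ≤ polydiscNorm R p * polydiscNorm R q := by
  conv_lhs => rw [p.as_sum, q.as_sum, Finset.sum_mul_sum]
  rw [polydiscNorm.eq_1 R p, polydiscNorm.eq_1 R q, Finset.sum_mul_sum]
  refine (polydiscNorm_sum_le hR _ _).trans (Finset.sum_le_sum fun d _ => ?_)
  refine (polydiscNorm_sum_le hR _ _).trans (Finset.sum_le_sum fun e _ => ?_)
  rw [monomial_mul, polydiscNorm_monomial, abs_mul, map_add, pow_add]
  exact le_of_eq (by ring)

/-- Differentiation costs a factor equal to the degree; the assumption `1 ≤ R` allows the lowered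
exponent to be ignored. -/
theorem polydiscNorm_pderiv_le (hR : 1 ≤ R) (i : σ) (p : MvPolynomial σ ℝ) :
    polydiscNorm R (pderiv i p) ≤ p.totalDegree * polydiscNorm R p := by
  conv_lhs => rw [p.as_sum, map_sum]
  rw [polydiscNorm.eq_1 R p, Finset.mul_sum]
  refine (polydiscNorm_sum_le (by linarith) _ _).trans (Finset.sum_le_sum fun d hd => ?_)
  rw [pderiv_monomial, polydiscNorm_monomial, abs_mul, Nat.abs_cast]
  have hdi : d i ≤ p.totalDegree :=
    (Finsupp.le_degree i d).trans (le_totalDegree hd)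
  have hdeg : (d - Finsupp.single i 1).degree ≤ d.degree :=
    Finsupp.degree_mono tsub_le_self
  calc |coeff d p| * (d i : ℝ) * R ^ (d - Finsupp.single i 1).degree
      ≤ |coeff d p| * (p.totalDegree : ℝ) * R ^ d.degree := by
        gcongr
    _ = _ := by ring

theorem abs_eval_le_polydiscNorm (p : MvPolynomial σ ℝ) {y : σ → ℝ} (hy : ∀ i, |y i| ≤ R) :
    |eval y p| ≤ polydiscNorm R p := by
  rw [eval_eq, polydiscNorm]
  refine (Finset.abs_sum_le_sum_abs _ _).trans (Finset.sum_le_sum fun d _ => ?_)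
  rw [abs_mul, Finset.abs_prod, Finsupp.degree_apply, ← Finset.prod_pow_eq_pow_sum]
  gcongr with i _
  rw [abs_pow]
  gcongr
  exact hy i

theorem totalDegree_pderiv_le (i : σ) (p : MvPolynomial σ ℝ) :
    (pderiv i p).totalDegree ≤ p.totalDegree := by
  conv_lhs => rw [p.as_sum, map_sum]
  refine totalDegree_finsetSum_le fun d hd => ?_
  rw [pderiv_monomial]
  exact (totalDegree_monomial_le _ _).trans
    ((Finsupp.degree_mono tsub_le_self).trans (le_totalDegree hd))

end Majorant

section LieBound

/-! ### Factorial growth of the iterated Lie derivatives -/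

variable {N : ℕ}

theorem exists_lie_bound (F : Fin N → MvPolynomial (Fin N) ℝ) {R : ℝ} (hR : 1 ≤ R) :
    ∃ (e : ℕ) (B : ℝ), 0 ≤ B ∧ ∀ p : MvPolynomial (Fin N) ℝ,
      (lie F p).totalDegree ≤ p.totalDegree + e ∧
      polydiscNorm R (lie F p) ≤ p.totalDegree * B * polydiscNorm R p := by
  have hR0 : 0 ≤ R := by linarith
  refine ⟨Finset.univ.sup fun i => (F i).totalDegree, ∑ i, polydiscNorm R (F i),
    Finset.sum_nonneg fun i _ => polydiscNorm_nonneg hR0 _, fun p => ⟨?_, ?_⟩⟩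
  · refine totalDegree_finsetSum_le fun i hi => (totalDegree_mul _ _).trans ?_
    exact add_le_add (totalDegree_pderiv_le i p)
      (Finset.le_sup (f := fun i => (F i).totalDegree) hi)
  · refine (polydiscNorm_sum_le hR0 _ _).trans ?_
    rw [Finset.mul_sum, Finset.sum_mul]
    refine Finset.sum_le_sum fun i _ => (polydiscNorm_mul_le hR0 _ _).trans ?_
    calc polydiscNorm R (pderiv i p) * polydiscNorm R (F i)
        ≤ (p.totalDegree * polydiscNorm R p) * polydiscNorm R (F i) := by
          gcongr
          · exact polydiscNorm_nonneg hR0 _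
          · exact polydiscNorm_pderiv_le hR i p
      _ = _ := by ring

/-- The degree of `ℒ⁽ʲ⁾(p)` grows linearly in `j` and each Lie derivative costs a factor proportional
to the degree; so the norm grows at most like `Kʲ j!`. -/
theorem exists_iterate_lie_bound (F : Fin N → MvPolynomial (Fin N) ℝ)
    (p : MvPolynomial (Fin N) ℝ) {R : ℝ} (hR : 1 ≤ R) :
    ∃ K : ℝ, 0 ≤ K ∧ ∀ j : ℕ,
      polydiscNorm R ((lie F)^[j] p) ≤ polydiscNorm R p * K ^ j * (j.factorial : ℝ) := by
  have hR0 : 0 ≤ R := by linarith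
  obtain ⟨e, B, hB, h⟩ := exists_lie_bound F hR
  have hdeg : ∀ j : ℕ, ((lie F)^[j] p).totalDegree ≤ p.totalDegree + j * e := by
    intro j
    induction j with
    | zero => simp
    | succ j ih =>
      rw [Function.iterate_succ_apply']
      refine (h _).1.trans ?_
      rw [add_mul]
      omega
  refine ⟨(p.totalDegree + e : ℕ) * B, by positivity, fun j => ?_⟩
  induction j with
  | zero => simp
  | succ j ih =>
    have hj : ((lie F)^[j] p).totalDegree ≤ (j + 1) * (p.totalDegree + e) :=
      (hdeg j).trans (by nlinarith [Nat.zero_le (j * p.totalDegree), Nat.zero_le e])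
    have hj' : (((lie F)^[j] p).totalDegree : ℝ) ≤ (j + 1) * (p.totalDegree + e : ℕ) := by
      exact_mod_cast hj
    rw [Function.iterate_succ_apply']
    calc _ ≤ _ := (h _).2
      _ ≤ ((j + 1) * (p.totalDegree + e : ℕ)) * B *
          (polydiscNorm R p * ((p.totalDegree + e : ℕ) * B) ^ j * (j.factorial : ℝ)) := by
        gcongr
        exact polydiscNorm_nonneg hR0 _
      _ = _ := by
        rw [Nat.factorial_succ, pow_succ]
        push_cast
        ring

end LieBound

section Analytic

/-! ### Analyticity from factorial bounds on the derivatives -/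

/-- If `g j` is the `j`-th derivative of `g 0` near `0` and `|g j| ≤ C Kʲ j!` there, then `g 0` is
analytic at `0`, with the Taylor series as its power series. -/
theorem hasFPowerSeriesAt_of_factorial_bound {g : ℕ → ℝ → ℝ} {δ C K : ℝ} (hδ : 0 < δ)
    (hK : 0 ≤ K)
    (hg : ∀ j, ∀ t ∈ Set.Ioo (-δ) δ, HasDerivAt (g j) (g (j + 1) t) t)
    (hb : ∀ j, ∀ t ∈ Set.Ioo (-δ) δ, |g j t| ≤ C * K ^ j * (j.factorial : ℝ)) :
    HasFPowerSeriesAt (g 0)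
      (FormalMultilinearSeries.ofScalars ℝ fun j => g j 0 / (j.factorial : ℝ)) 0 := by
  have hC : 0 ≤ C := by simpa using (abs_nonneg _).trans (hb 0 0 ⟨by linarith, hδ⟩)
  rw [hasFPowerSeriesAt_iff]
  have hnhds : ∀ᶠ y : ℝ in 𝓝 0, y ∈ Set.Ioo (-δ) δ ∧ K * |y| < 1 := by
    refine Filter.Eventually.and (Ioo_mem_nhds (neg_lt_zero.2 hδ) hδ) ?_
    have : Tendsto (fun y : ℝ => K * |y|) (𝓝 0) (𝓝 (K * |0|)) :=
      (continuous_const.mul continuous_abs).tendsto 0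
    exact this.eventually_lt_const (by simp)
  filter_upwards [hnhds] with y ⟨hy, hKy⟩
  have h0 : (0 : ℝ) ∈ Set.Ioo (-δ) δ := ⟨by linarith, hδ⟩
  have hq : 0 ≤ K * |y| := by positivity
  simp only [FormalMultilinearSeries.coeff_ofScalars, smul_eq_mul, zero_add]
  have hterm : ∀ j : ℕ, ‖y ^ j * (g j 0 / (j.factorial : ℝ))‖ ≤ C * (K * |y|) ^ j := by
    intro j
    have hfac : (0 : ℝ) < j.factorial := by exact_mod_cast j.factorial_pos
    rw [Real.norm_eq_abs, abs_mul, abs_div, abs_pow, Nat.abs_cast, mul_div_assoc', div_le_iff₀ hfac,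
      mul_pow]
    calc |y| ^ j * |g j 0| ≤ |y| ^ j * (C * K ^ j * j.factorial) := by gcongr; exact hb j 0 h0
      _ = _ := by ring
  rw [hasSum_iff_tendsto_nat_of_summable_norm (Summable.of_nonneg_of_le (fun _ => norm_nonneg _)
    hterm ((summable_geometric_of_lt_one hq hKy).mul_left C))]
  -- the Taylor polynomial at `s`, evaluated at `y`, as a function of the base point `s`
  let φ : ℕ → ℝ → ℝ := fun k s => ∑ j ∈ Finset.range k, (y - s) ^ j * (g j s / (j.factorial : ℝ))
  -- its derivative telescopes
  have hφ : ∀ k, ∀ s ∈ Set.Ioo (-δ) δ,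
      HasDerivAt (φ (k + 1)) ((y - s) ^ k * (g (k + 1) s / (k.factorial : ℝ))) s := by
    intro k s hs
    induction k with
    | zero => simpa [φ] using hg 0 s hs
    | succ k ih =>
      have h1 : HasDerivAt (fun s => (y - s) ^ (k + 1))
          (((k + 1 : ℕ) : ℝ) * (y - s) ^ k * (-1)) s := by
        simpa using ((hasDerivAt_id s).const_sub y).fun_pow (k + 1)
      have h2 := (ih.add (h1.mul ((hg (k + 1) s hs).div_const ((k + 1).factorial : ℝ))))
      have h3 : φ (k + 1 + 1) = φ (k + 1) +
          (fun s => (y - s) ^ (k + 1)) * fun s => g (k + 1) s / ((k + 1).factorial : ℝ) := by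
        ext s
        simp [φ, Finset.sum_range_succ _ (k + 1)]
      rw [h3]
      refine h2.congr_deriv ?_
      have hfac : ((k.factorial : ℕ) : ℝ) ≠ 0 := by exact_mod_cast k.factorial_ne_zero
      rw [Nat.factorial_succ]
      push_cast
      field_simp
      ring
  have hsub : Set.uIcc 0 y ⊆ Set.Ioo (-δ) δ :=
    (Set.ordConnected_Ioo).uIcc_subset h0 hy
  -- mean value inequality for `φ (k + 1)` between `0` and `y`, where it takes the values of the
  -- Taylor polynomial and of `g 0 y`
  have hbound : ∀ k : ℕ,
      |φ (k + 1) 0 - g 0 y| ≤ C * K * |y| * (((k + 1 : ℕ) : ℝ) * (K * |y|) ^ k) := by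
    intro k
    have hφy : φ (k + 1) y = g 0 y := by
      simp [φ, Finset.sum_range_succ', pow_succ]
    rw [abs_sub_comm, ← hφy, ← Real.norm_eq_abs]
    refine ((convex_uIcc 0 y).norm_image_sub_le_of_norm_hasDerivWithin_le
      (C := C * K * (((k + 1 : ℕ) : ℝ) * (K * |y|) ^ k))
      (fun s hs => (hφ k s (hsub hs)).hasDerivWithinAt) (fun s hs => ?_)
      Set.left_mem_uIcc Set.right_mem_uIcc).trans (le_of_eq ?_)
    · have hfac : (0 : ℝ) < k.factorial := by exact_mod_cast k.factorial_pos
      have hys : |y - s| ≤ |y| := by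
        simpa using Set.abs_sub_right_of_mem_uIcc hs
      rw [Real.norm_eq_abs, abs_mul, abs_div, abs_pow, Nat.abs_cast, mul_div_assoc',
        div_le_iff₀ hfac]
      calc |y - s| ^ k * |g (k + 1) s|
          ≤ |y| ^ k * (C * K ^ (k + 1) * ((k + 1).factorial : ℝ)) := by
            gcongr
            exact hb _ s (hsub hs)
        _ = _ := by
            rw [Nat.factorial_succ]
            push_cast
            ring
    · rw [sub_zero, Real.norm_eq_abs]
      ring
  have hlim : Tendsto (fun k : ℕ => C * K * |y| * (((k + 1 : ℕ) : ℝ) * (K * |y|) ^ k)) atTop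
      (𝓝 0) := by
    have h1 := (tendsto_self_mul_const_pow_of_lt_one hq hKy).add
      (tendsto_pow_atTop_nhds_zero_of_lt_one hq hKy)
    have h2 := h1.const_mul (C * K * |y|)
    simp only [add_zero, mul_zero] at h2
    refine h2.congr fun k => ?_
    push_cast
    ring
  have hφlim : Tendsto (fun k => φ (k + 1) 0) atTop (𝓝 (g 0 y)) := by
    rw [tendsto_iff_norm_sub_tendsto_zero]
    exact squeeze_zero (fun _ => norm_nonneg _) hbound hlim
  simpa [φ] using (tendsto_add_atTop_iff_nat (f := fun k => φ k 0) 1).1 hφlim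

theorem taylorSeries_eq_of_hasFPowerSeriesAt {g : ℝ → ℝ} {s : FormalMultilinearSeries ℝ ℝ ℝ}
    (h : HasFPowerSeriesAt g s 0) : taylorSeries g = s :=
  h.analyticAt.hasFPowerSeriesAt.eq_formalMultilinearSeries h

end Analytic

section Flow

/-! ### Polynomials along trajectories -/

variable {N : ℕ}

theorem hasDerivAt_eval_of_hasDerivAt (F : Fin N → MvPolynomial (Fin N) ℝ) {x : ℝ → Fin N → ℝ}
    {t : ℝ} (hx : HasDerivAt x (fun i => eval (x t) (F i)) t) (p : MvPolynomial (Fin N) ℝ) :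
    HasDerivAt (fun s => eval (x s) p) (eval (x t) (lie F p)) t := by
  induction p using MvPolynomial.induction_on with
  | C a => simpa [lie_C] using hasDerivAt_const t a
  | add p q hp hq => simpa [lie_add] using hp.fun_add hq
  | mul_X p i hp =>
    have := hp.mul ((hasDerivAt_pi.1 hx) i)
    simp only [map_mul, eval_X, lie_mul, lie_X, map_add]
    refine this.congr_deriv ?_
    ring

/-- Along a local solution, `p` is analytic at `0` and its Taylor coefficients are the values
`ℒ⁽ʲ⁾(p)(x₀) / j!`. -/
theorem IsLocalSolution.hasFPowerSeriesAt_eval {F : Fin N → MvPolynomial (Fin N) ℝ}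
    {x₀ : Fin N → ℝ} {x : ℝ → Fin N → ℝ} (hx : IsLocalSolution F x₀ x)
    (p : MvPolynomial (Fin N) ℝ) :
    HasFPowerSeriesAt (fun t => eval (x t) p) (FormalMultilinearSeries.ofScalars ℝ
      fun j => eval x₀ ((lie F)^[j] p) / (j.factorial : ℝ)) 0 := by
  obtain ⟨hx0, ε, hε, hx⟩ := hx
  have hcont : ContinuousAt x 0 := (hx 0 ⟨by linarith, hε⟩).continuousAt
  have hev : ∀ᶠ t in 𝓝 (0 : ℝ), t ∈ Set.Ioo (-ε) ε ∧ ‖x t‖ < ‖x 0‖ + 1 :=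
    Filter.Eventually.and (Ioo_mem_nhds (neg_lt_zero.2 hε) hε) (hcont.norm.eventually_lt_const (by simp))
  obtain ⟨δ, hδ, hball⟩ := Metric.eventually_nhds_iff_ball.1 hev
  rw [Real.ball_eq_Ioo, zero_sub, zero_add] at hball
  obtain ⟨K, hK, hbound⟩ := exists_iterate_lie_bound F p (R := ‖x 0‖ + 1) (by simp)
  have := hasFPowerSeriesAt_of_factorial_bound (g := fun j t => eval (x t) ((lie F)^[j] p))
    (C := polydiscNorm (‖x 0‖ + 1) p) hδ hK (fun j t ht => ?_) (fun j t ht => ?_)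
  · simpa only [Function.iterate_zero, id_eq, hx0] using this
  · simp only [Function.iterate_succ_apply']
    exact hasDerivAt_eval_of_hasDerivAt F (hx t (hball t ht).1) _
  · refine (abs_eval_le_polydiscNorm _ fun i => ?_).trans (hbound j)
    exact (norm_le_pi_norm (x t) i).trans (hball t ht).2.le

variable (F : Fin N → MvPolynomial (Fin N) ℝ) (x₀ : Fin N → ℝ)

theorem isLocalSolution_localSolution : IsLocalSolution F x₀ (localSolution F x₀) :=
  Classical.choose_spec (exists_isLocalSolution F x₀)

theorem hasFPowerSeriesAt_localSolution (i : Fin N) :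
    HasFPowerSeriesAt (fun t => localSolution F x₀ t i)
      (taylorSeries fun t => localSolution F x₀ t i) 0 := by
  have h := (isLocalSolution_localSolution F x₀).hasFPowerSeriesAt_eval (X i)
  simp only [eval_X] at h
  exact h.analyticAt.hasFPowerSeriesAt

theorem trajectory_eventuallyEq : trajectory F x₀ =ᶠ[𝓝 0] localSolution F x₀ := by
  have h : ∀ᶠ t in 𝓝 (0 : ℝ), ∀ i, trajectory F x₀ t i = localSolution F x₀ t i := by
    refine eventually_all.2 fun i => ?_
    filter_upwards [(hasFPowerSeriesAt_localSolution F x₀ i).eventually_hasSum] with t ht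
    rw [zero_add] at ht
    exact ht.tsum_eq
  filter_upwards [h] with t ht using funext ht

theorem hasFPowerSeriesAt_eval_trajectory (p : MvPolynomial (Fin N) ℝ) :
    HasFPowerSeriesAt (fun t => eval (trajectory F x₀ t) p) (FormalMultilinearSeries.ofScalars ℝ
      fun j => eval x₀ ((lie F)^[j] p) / (j.factorial : ℝ)) 0 := by
  refine ((isLocalSolution_localSolution F x₀).hasFPowerSeriesAt_eval p).congr ?_
  filter_upwards [trajectory_eventuallyEq F x₀] with t ht
  rw [ht]

theorem eval_trajectory_eventuallyEq_zero_iff (p : MvPolynomial (Fin N) ℝ) :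
    (fun t => eval (trajectory F x₀ t) p) =ᶠ[𝓝 0] 0 ↔ ∀ j, eval x₀ ((lie F)^[j] p) = 0 := by
  have h := hasFPowerSeriesAt_eval_trajectory F x₀ p
  constructor
  · intro h0 j
    have hs := (FormalMultilinearSeries.ofScalars_series_eq_zero ℝ).1 (h.eq_zero_of_eventually h0)
    have := congrFun hs j
    simpa [Nat.factorial_ne_zero] using this
  · intro h0
    filter_upwards [h.eventually_hasSum] with t ht
    simp only [h0, FormalMultilinearSeries.ofScalars_apply_eq, zero_div, zero_smul, zero_add] at ht
    exact ht.unique hasSum_zero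

theorem isPolynomialInvariant_iff (p : MvPolynomial (Fin N) ℝ) :
    IsPolynomialInvariant F x₀ p ↔ ∀ j, eval x₀ ((lie F)^[j] p) = 0 := by
  have h := hasFPowerSeriesAt_eval_trajectory F x₀ p
  have hs : behaviourSeries F x₀ p = _ := taylorSeries_eq_of_hasFPowerSeriesAt h
  constructor
  · intro hp
    rw [← eval_trajectory_eventuallyEq_zero_iff]
    have hrad : Metric.eball (0 : ℝ) (behaviourSeries F x₀ p).radius ∈ 𝓝 0 :=
      Metric.eball_mem_nhds _ (by rw [hs]; exact h.radius_pos)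
    filter_upwards [h.eventually_hasSum, hrad] with t ht htr
    rw [zero_add, ← hs] at ht
    rw [Metric.mem_eball, edist_zero_right, ← ofReal_norm, Real.norm_eq_abs] at htr
    rw [← ht.tsum_eq]
    exact hp t htr
  · intro h0 t _
    rw [hs]
    simp [h0, FormalMultilinearSeries.sum]

theorem trajectoryDomain_eq_eball : trajectoryDomain F x₀ =
    Metric.eball 0 (⨅ i : Fin N, (taylorSeries fun s => localSolution F x₀ s i).radius) := by
  ext t
  rw [Metric.mem_eball, edist_zero_right, ← ofReal_norm, Real.norm_eq_abs]
  rfl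

theorem zero_mem_trajectoryDomain : (0 : ℝ) ∈ trajectoryDomain F x₀ := by
  change ENNReal.ofReal |0| < _
  rw [abs_zero, ENNReal.ofReal_zero]
  rcases isEmpty_or_nonempty (Fin N) with h | h
  · rw [iInf_of_empty]
    exact ENNReal.zero_lt_top
  · obtain ⟨i, hi⟩ := exists_eq_ciInf_of_finite
      (f := fun i : Fin N => (taylorSeries fun s => localSolution F x₀ s i).radius)
    rw [← hi]
    exact (hasFPowerSeriesAt_localSolution F x₀ i).radius_pos

theorem analyticOnNhd_eval_trajectory (p : MvPolynomial (Fin N) ℝ) :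
    AnalyticOnNhd ℝ (fun t => eval (trajectory F x₀ t) p) (trajectoryDomain F x₀) := by
  intro t ht
  refine AnalyticAt.aeval_mvPolynomial (fun i => ?_) p
  refine (FormalMultilinearSeries.hasFPowerSeriesOnBall _
    (hasFPowerSeriesAt_localSolution F x₀ i).radius_pos).analyticOnNhd t ?_
  rw [trajectoryDomain_eq_eball] at ht
  exact Metric.eball_subset_eball (iInf_le _ i) ht

theorem eval_trajectory_eq_zero_iff (p : MvPolynomial (Fin N) ℝ) :
    (∀ t ∈ trajectoryDomain F x₀, eval (trajectory F x₀ t) p = 0) ↔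
      ∀ j, eval x₀ ((lie F)^[j] p) = 0 := by
  rw [← eval_trajectory_eventuallyEq_zero_iff]
  have h0 := zero_mem_trajectoryDomain F x₀
  have hD := trajectoryDomain_eq_eball F x₀
  constructor
  · intro h
    have : trajectoryDomain F x₀ ∈ 𝓝 0 := (hD ▸ Metric.isOpen_eball).mem_nhds h0
    filter_upwards [this] with t ht using h t ht
  · intro h
    exact (analyticOnNhd_eval_trajectory F x₀ p).eqOn_zero_of_preconnected_of_eventuallyEq_zero
      (hD ▸ Metric.isPreconnected_eball) h0 h

/-- `p` vanishes on `φ_ψ` iff it vanishes along every trajectory from `ψ` (the zero locus of `p` is then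
itself one of the competing varieties), iff all its Lie derivatives vanish on `ψ`. -/
theorem mem_postIdeal_iff {ψ : Set (Fin N → ℝ)} {p : MvPolynomial (Fin N) ℝ} :
    p ∈ postIdeal F ψ ↔ ∀ j, (lie F)^[j] p ∈ vanishingIdeal ℝ ψ := by
  have h : p ∈ postIdeal F ψ ↔
      ∀ x₀ ∈ ψ, ∀ t ∈ trajectoryDomain F x₀, eval (trajectory F x₀ t) p = 0 := by
    simp only [postIdeal, mem_vanishingIdeal_iff, aeval_eq_eval]
    constructor
    · intro hp x₀ hx₀ t ht
      exact hp _ fun φ hφ => hφ.2 x₀ hx₀ t ht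
    · intro hp y hy
      have hz : y ∈ zeroLocus ℝ (Ideal.span {p}) := by
        refine hy _ ⟨⟨{p}, rfl⟩, fun x₀ hx₀ t ht => ?_⟩
        rw [zeroLocus_span]
        rintro q rfl
        rw [aeval_eq_eval]
        exact hp x₀ hx₀ t ht
      simpa [aeval_eq_eval] using hz p (Ideal.mem_span_singleton_self p)
  rw [h]
  simp only [eval_trajectory_eq_zero_iff, mem_vanishingIdeal_iff, aeval_eq_eval]
  exact ⟨fun h j x hx => h x hx j, fun h x hx j => h j x hx⟩

end Flow

end PolyODE

theorem theorem1 {N n : ℕ} (F : Fin N → MvPolynomial (Fin N) ℝ)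
    (ψ : Set (Fin N → ℝ)) (hψ : IsAlgebraicVariety ψ)
    (π : MvPolynomial (Fin n ⊕ Fin N) ℝ) (hπ : IsTemplate π)
    (mx : MonomialOrder (Fin N)) (m : MonomialOrder (Fin n ⊕ Fin N)) (hm : IsRestriction mx m)
    (G : Finset (MvPolynomial (Fin N) ℝ))
    (hG : IsGroebnerBasis mx G (MvPolynomial.vanishingIdeal ℝ ψ))
    (V : Set (Fin n → ℝ)) (J : Ideal (MvPolynomial (Fin N) ℝ))
    (hVJ : post F m G π = (V, J)) :
    -- the algorithm terminates
    (stopSet F m G π).Nonempty ∧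
    -- (a)
    instSet π V = instSet π Set.univ ∩ (postIdeal F ψ : Set (MvPolynomial (Fin N) ℝ)) ∧
    instSet π V = {p ∈ instSet π Set.univ | ∀ x₀ ∈ ψ, IsPolynomialInvariant F x₀ p} ∧
    -- (b)
    IsLeast {I : Ideal (MvPolynomial (Fin N) ℝ) |
      IsInvariantIdeal F I ∧ instSet π V ⊆ (I : Set (MvPolynomial (Fin N) ℝ))} J ∧
    J ≤ postIdeal F ψ := by
  have hi := Nat.sInf_mem (stopSet_nonempty (F := F) hm hG hπ)
  obtain ⟨rfl, rfl⟩ := Prod.mk.inj hVJ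
  have hV : ∀ v, v ∈ postV F m G π (sInf (stopSet F m G π)) ↔ inst v π ∈ postIdeal F ψ :=
    fun v => (mem_postV_iff_of_mem_stopSet hm hG hi).trans (mem_postIdeal_iff F).symm
  refine ⟨⟨_, hi⟩, ?_, ?_, isLeast_postJ hi, fun p hp => (mem_postIdeal_iff F).2 fun j =>
    postJ_le hm hG _ ((isInvariantIdeal_postJ hi).iterate_lie_mem hp j)⟩
  · ext p
    constructor
    · rintro ⟨v, hv, rfl⟩
      exact ⟨⟨v, trivial, rfl⟩, (hV v).1 hv⟩
    · rintro ⟨⟨v, -, rfl⟩, hp⟩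
      exact ⟨v, (hV v).2 hp, rfl⟩
  · have hinv : ∀ p, p ∈ postIdeal F ψ ↔ ∀ x₀ ∈ ψ, IsPolynomialInvariant F x₀ p := by
      intro p
      simp only [mem_postIdeal_iff, isPolynomialInvariant_iff, MvPolynomial.mem_vanishingIdeal_iff,
        MvPolynomial.aeval_eq_eval]
      exact ⟨fun h x hx j => h j x hx, fun h j x hx => h x hx j⟩
    ext p
    constructor
    · rintro ⟨v, hv, rfl⟩
      exact ⟨⟨v, trivial, rfl⟩, (hinv _).1 ((hV v).1 hv)⟩
    · rintro ⟨⟨v, -, rfl⟩, hp⟩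
      exact ⟨v, (hV v).2 ((hinv _).2 hp), rfl⟩
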